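/- Let $\mathcal H$ be a real Hilbert space, let $A:\mathcal H\rightrightarrows\mathcal H$ be maximal monotone, $B:\mathcal H\to\mathcal H$ monotone and $\ell$-Lipschitz continuous ($\ell\ge 0$), $C:\mathcal H\to\mathcal H$ $\beta$-cocoercive with $\beta\in(0,\infty]$, i.e. $\langle x-y,C(x)-C(y)\rangle\ge\beta\|C(x)-C(y)\|^2$ for all $x,y$ (with the conventions $\infty\cdot 0=0$ and $1/\infty=0$), $D:\mathcal H\to\mathcal H$ monotone and continuously differentiable with an $m$-Lipschitz continuous derivative $D'$ ($m\ge 0$), and $G:\mathcal H\to\mathcal H$ bounded and linear. Let $z,w\in\mathcal H$, $\hat\delta>0$ and $0<\theta_-<\theta_+<\infty$. For $u,x\in\mathcal H$ put $D_{(u)}(x):=D(u)+D'(u)(x-u)$, let $J_T:=(T+I)^{-1}$ denote the resolvent of $T$, and for $\rho>0$ put $$x(\rho):=J_{\rho(A+D_{(Gz)})}\bigl(Gz+\rho w-\rho(B+C)(Gz)\bigr),\qquad \psi(\rho):=4\ell^2\rho^2+(\beta^{-1}+\hat\delta)\rho+(m\rho\|x(\rho)-Gz\|)^2 .$$ Consider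 the following bracketing/bisection procedure. 1. Choose $\rho^0>0$ and compute $x(\rho^0)$. If $\theta_-\le\psi(\rho^0)\le\theta_+$, stop and return $(\rho,x,y)$ with $\rho=\rho^0$, $x=x(\rho)$ and $y=(Gz-x)/\rho+w+[B(x)-B(Gz)]+[D(x)-D_{(Gz)}(x)]$. If $\psi(\rho^0)<\theta_-$, set $t_-:=\rho^0$ and $t_+:=\rho^0\theta_+/\psi(\rho^0)$. If $\psi(\rho^0)>\theta_+$, set $t_-:=\rho^0\theta_- /\psi(\rho^0)$ and $t_+:=\rho^0$. 2. Set $\tilde\rho:=\sqrt{t_-t_+}$ and compute $x(\tilde\rho)$. If $\theta_-\le\psi(\tilde\rho)\le\theta_+$, stop and return $(\rho,x,y)$ with $\rho=\tilde\rho$, $x=x(\rho)$ and $y$ given by the same formula. If $\psi(\tilde\rho)>\theta_+$, set $t_+:=\tilde\rho$; if $\psi(\tilde\rho)<\theta_-$, set $t_-:=\tilde\rho$. Repeat step 2. Assume that $w\notin(A+B+C+D)(Gz)$. Then, for every choice of $\rho^0>0$, the resolvents that the procedure evaluates are well defined (single-valued and nonempty at the points in question), and the procedure terminates after finitely many steps.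 It returns a triple $(\rho,x,y)$ with $\rho>0$, $$x=J_{\rho(A+D_{(Gz)})}\bigl(Gz+\rho w-\rho(B+C)(Gz)\bigr),\qquad \theta_-\le 4\ell^2\rho^2+(\beta^{-1}+\hat\delta)\rho+(m\rho\|x-Gz\|)^2\le\theta_+,$$ $$y=(Gz-x)/\rho+w+[B(x)-B(Gz)]+[D(x)-D_{(Gz)}(x)].$$ -/

import Mathlib

open scoped Pointwise NNReal ENNReal

noncomputable section

namespace SetOp

variable {H : Type*} [NormedAddCommGroup H] [InnerProductSpace ℝ H]

/- A set-valued map from `H` to `H` is a function `H → Set H`.  With `Pointwise` open, `T + S` is the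
Minkowski sum and `ρ • T` the scaled operator, both taken point by point. -/

/-- A point-to-point map, seen as a set-valued one. -/
def ofFun (F : H → H) : H → Set H := fun x => {F x}

/-- The graph of a set-valued map. -/
def graph (T : H → Set H) : Set (H × H) := {p | p.2 ∈ T p.1}

/-- Monotone operators. -/
def IsMonotone (T : H → Set H) : Prop :=
  ∀ z z' v v' : H, v ∈ T z → v' ∈ T z' → 0 ≤ inner ℝ (z - z') (v - v')

/-- Maximal monotone operators: the graph is not properly contained in the graph of another monotone
operator. -/
def IsMaximalMonotone (T : H → Set H) : Prop :=
  IsMonotone T ∧ ∀ S : H → Set H, IsMonotone S → ¬ graph T ⊂ graph S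

/-- The inverse of a set-valued map. -/
def inverse (T : H → Set H) : H → Set H := fun z => {v | z ∈ T v}

/-- The resolvent `J_T = (T + I)⁻¹`, as a set-valued map.  The equation `x = J_T(s)` is written
`resolvent T s = {x}`. -/
def resolvent (T : H → Set H) : H → Set H := inverse (T + ofFun (fun x => x))

/-- `C` is `β`-cocoercive, for `β` in `[0, ∞]` (with `∞ * 0 = 0`):
`⟨x - y, C x - C y⟩ ≥ β ‖C x - C y‖²` for all `x`, `y`. -/
def IsCocoercive (β : ℝ≥0∞) (C : H → H) : Prop :=
  ∀ x y : H, (β : EReal) * ((‖C x - C y‖ ^ 2 : ℝ) : EReal) ≤ ((inner ℝ (x - y) (C x - C y) : ℝ) : EReal)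

/-- The first-order approximation `D_(u)(x) = D(u) + D'(u)(x - u)`. -/
def linearization (D : H → H) (u : H) : H → H := fun x => D u + fderiv ℝ D u (x - u)

end SetOp

/-- The data of the problem (the hypotheses on them are not included here). -/
structure BBData (H : Type*) [NormedAddCommGroup H] [InnerProductSpace ℝ H] where
  /-- the set-valued operator -/
  A : H → Set H
  /-- the Lipschitz operator -/
  B : H → H
  /-- the cocoercive operator -/
  C : H → H
  /-- the smooth operator -/
  D : H → H
  /-- the bounded linear operator -/
  G : H →L[ℝ] H
  z : H
  w : H
  /-- Lipschitz constant of `B` -/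
  ℓ : ℝ≥0
  /-- cocoercivity constant of `C`, possibly infinite -/
  β : ℝ≥0∞
  /-- Lipschitz constant of the derivative of `D` -/
  m : ℝ≥0
  /-- lower bound of the window -/
  θlo : ℝ
  /-- upper bound of the window -/
  θhi : ℝ
  /-- the constant `δ̂` -/
  δ : ℝ

/-- The configurations of the bracketing/bisection procedure. -/
inductive BBState (H : Type*) where
  /-- the trial value `ρ⁰` has been chosen -/
  | init (ρ₀ : ℝ)
  /-- the procedure is at the head of the bisection loop, with current values of `t₋` and `t₊` -/
  | bisect (tlo thi : ℝ)
  /-- the procedure has returned the triple `(ρ, x, y)` -/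
  | ret (ρ : ℝ) (x y : H)

namespace BBData

open SetOp

variable {H : Type*} [NormedAddCommGroup H] [InnerProductSpace ℝ H] (P : BBData H)

/-- `x = J_{ρ(A + D_(Gz))}(Gz + ρ w - ρ (B + C)(Gz))`. -/
def IsProxPoint (ρ : ℝ) (x : H) : Prop :=
  resolvent (ρ • (P.A + ofFun (linearization P.D (P.G P.z))))
    (P.G P.z + ρ • P.w - ρ • (P.B (P.G P.z) + P.C (P.G P.z))) = {x}

/-- `4 ℓ² ρ² + (β⁻¹ + δ̂) ρ + (m ρ ‖x - Gz‖)²`, with `∞⁻¹ = 0`. -/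
def psi (ρ : ℝ) (x : H) : ℝ :=
  4 * (P.ℓ : ℝ) ^ 2 * ρ ^ 2 + ((P.β⁻¹).toReal + P.δ) * ρ + ((P.m : ℝ) * ρ * ‖x - P.G P.z‖) ^ 2

/-- `(Gz - x)/ρ + w + [B(x) - B(Gz)] + [D(x) - D_(Gz)(x)]`. -/
def yOut (ρ : ℝ) (x : H) : H :=
  ρ⁻¹ • (P.G P.z - x) + P.w + (P.B x - P.B (P.G P.z))
    + (P.D x - linearization P.D (P.G P.z) x)

/-- One step of the bracketing/bisection procedure: compute the resolvent at the current trial value,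
test the window and branch.  From `init` this is the bracketing phase, from `bisect` it is one pass
through the bisection loop, whose trial value is the geometric mean of `t₋` and `t₊`. -/
inductive Step : BBState H → BBState H → Prop
  | init_ret (ρ : ℝ) (x : H) : P.IsProxPoint ρ x →
      P.θlo ≤ P.psi ρ x → P.psi ρ x ≤ P.θhi →
      Step (.init ρ) (.ret ρ x (P.yOut ρ x))
  | init_lt (ρ : ℝ) (x : H) : P.IsProxPoint ρ x → P.psi ρ x < P.θlo →
      Step (.init ρ) (.bisect ρ (ρ * P.θhi / P.psi ρ x))
  | init_gt (ρ : ℝ) (x : H) : P.IsProxPoint ρ x → P.psi ρ x > P.θhi →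
      Step (.init ρ) (.bisect (ρ * P.θlo / P.psi ρ x) ρ)
  | bisect_ret (tlo thi : ℝ) (x : H) : P.IsProxPoint √(tlo * thi) x →
      P.θlo ≤ P.psi √(tlo * thi) x → P.psi √(tlo * thi) x ≤ P.θhi →
      Step (.bisect tlo thi) (.ret √(tlo * thi) x (P.yOut √(tlo * thi) x))
  | bisect_gt (tlo thi : ℝ) (x : H) : P.IsProxPoint √(tlo * thi) x →
      P.psi √(tlo * thi) x > P.θhi →
      Step (.bisect tlo thi) (.bisect tlo √(tlo * thi))
  | bisect_lt (tlo thi : ℝ) (x : H) : P.IsProxPoint √(tlo * thi) x →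
      P.psi √(tlo * thi) x < P.θlo →
      Step (.bisect tlo thi) (.bisect √(tlo * thi) thi)

/-- `σ'` is reached from `σ` in finitely many steps. -/
def Reaches : BBState H → BBState H → Prop := Relation.ReflTransGen P.Step

end BBData

end

/-! Write `T = A + D_(Gz)`. The resolvents of `ρT` are single-valued and everywhere defined: Minty's
theorem handles `A`, and a contraction argument adds the monotone Lipschitz map `D_(Gz)`.

Termination needs no continuity of `ψ`, only two comparisons. Monotonicity of `T` makes `‖x(ρ) -
Gz‖` nondecreasing and `‖x(ρ) - Gz‖ / ρ` nonincreasing in `ρ`. So `ψ(ρ) / ρ` is nondecreasing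
(`mul_psi_le`), which makes the initial interval a bracket: `ψ ≤ θlo` on the left and `ψ ≥ θhi` on
the right. And `ψ(ρ) / ρ ^ 4` is nonincreasing (`psi_le_div_pow_mul`), so every bracket satisfies
`θhi / θlo ≤ (thi / tlo) ^ 4` (`IsBracket.div_le_pow`). Each pass that does not return preserves the
bracket and takes the square root of `thi / tlo`; this ratio would tend to `1` in an infinite run, a
contradiction. -/

/-! ### Common points of monotone relations, by finite minimax and completeness -/

namespace MonotoneRelation

open Filter Topology

variable {H : Type*} [NormedAddCommGroup H] [InnerProductSpace ℝ H]

/-- The quadratic `x ↦ ⟪x - a, x + b⟫`; it is nonpositive exactly where `(x, -x)` is monotonically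
related to `(a, b)`. -/
def gap (p : H × H) (x : H) : ℝ := inner ℝ (x - p.1) (x + p.2)

lemma gap_eq (p : H × H) (x : H) :
    gap p x = ‖x‖ ^ 2 + inner ℝ x (p.2 - p.1) - inner ℝ p.1 p.2 := by
  simp only [gap, inner_sub_left, inner_add_right, inner_sub_right, real_inner_self_eq_norm_sq,
    real_inner_comm x p.1]
  ring

/-- Twice the difference of the two sides is the double sum of `l i * l j * ⟪a i - a j, b i - b j⟫`.
-/
lemma sum_mul_inner_ge {ι : Type*} [Fintype ι] (a b : ι → H)
    (hmono : ∀ i j, 0 ≤ inner ℝ (a i - a j) (b i - b j)) {l : ι → ℝ} (hl : l ∈ stdSimplex ℝ ι) :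
    inner ℝ (∑ i, l i • a i) (∑ i, l i • b i) ≤ ∑ i, l i * inner ℝ (a i) (b i) := by
  have h0 : 0 ≤ ∑ i, ∑ j, l i * (l j * inner ℝ (a i - a j) (b i - b j)) :=
    Finset.sum_nonneg fun i _ => Finset.sum_nonneg fun j _ =>
      mul_nonneg (hl.1 i) (mul_nonneg (hl.1 j) (hmono i j))
  have h1 : ∑ i, ∑ j, l i * (l j * inner ℝ (a i - a j) (b i - b j)) =
      2 * (∑ i, l i * inner ℝ (a i) (b i)) - 2 * inner ℝ (∑ i, l i • a i) (∑ i, l i • b i) := by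
    have e1 : ∑ i, ∑ j, l i * (l j * inner ℝ (a i) (b i)) = ∑ i, l i * inner ℝ (a i) (b i) := by
      refine Finset.sum_congr rfl fun i _ => ?_
      rw [← Finset.mul_sum, ← Finset.sum_mul, hl.2, one_mul]
    have e2 : ∑ i, ∑ j, l i * (l j * inner ℝ (a j) (b j)) = ∑ i, l i * inner ℝ (a i) (b i) := by
      rw [Finset.sum_comm, ← e1]
      refine Finset.sum_congr rfl fun i _ => Finset.sum_congr rfl fun j _ => by ring
    have e3 : ∑ i, ∑ j, l i * (l j * inner ℝ (a i) (b j)) =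
        inner ℝ (∑ i, l i • a i) (∑ i, l i • b i) := by
      simp only [sum_inner, inner_sum, real_inner_smul_left, real_inner_smul_right]
      rw [Finset.sum_comm]
      refine (Finset.sum_congr rfl fun i _ => Finset.sum_congr rfl fun j _ => by ring)
    have e4 : ∑ i, ∑ j, l i * (l j * inner ℝ (a j) (b i)) =
        inner ℝ (∑ i, l i • a i) (∑ i, l i • b i) := by
      rw [Finset.sum_comm, ← e3]
      refine Finset.sum_congr rfl fun i _ => Finset.sum_congr rfl fun j _ => by ring
    calc _ = ∑ i, ∑ j, (l i * (l j * inner ℝ (a i) (b i)) + l i * (l j * inner ℝ (a j) (b j))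
          - l i * (l j * inner ℝ (a i) (b j)) - l i * (l j * inner ℝ (a j) (b i))) := by
          refine Finset.sum_congr rfl fun i _ => Finset.sum_congr rfl fun j _ => ?_
          simp only [inner_sub_left, inner_sub_right]
          ring
      _ = _ := by
          simp only [Finset.sum_sub_distrib, Finset.sum_add_distrib, e1, e2, e3, e4]
          ring
  linarith

/-- The minimax value of finitely many gaps of a monotone family is nonpositive, and it is attained
with quadratic growth. -/
lemma exists_minimax_gap {ι : Type*} [Fintype ι] [Nonempty ι] (p : ι → H × H)
    (hmono : ∀ i j, 0 ≤ inner ℝ ((p i).1 - (p j).1) ((p i).2 - (p j).2)) :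
    ∃ (x : H) (r : ℝ), r ≤ 0 ∧ (∀ i, gap (p i) x ≤ r) ∧
      ∀ (y : H) (r' : ℝ), (∀ i, gap (p i) y ≤ r') → r + ‖y - x‖ ^ 2 ≤ r' := by
  classical
  let v : (ι → ℝ) → H := fun l => ∑ i, l i • ((p i).2 - (p i).1)
  let c : (ι → ℝ) → ℝ := fun l => ∑ i, l i * inner ℝ (p i).1 (p i).2
  let q : (ι → ℝ) → ℝ := fun l => -(‖v l‖ ^ 2 / 4) - c l
  have hq : Continuous q := by fun_prop
  -- `q` is the dual function: `q l` is the minimum over `H` of the `l`-weighted mean of the gaps,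
  -- attained at `-v l / 2`. A dual maximizer gives the minimax point.
  obtain ⟨l, hl, hmax⟩ := (isCompact_stdSimplex ℝ ι).exists_isMaxOn
    ⟨_, single_mem_stdSimplex ℝ (Classical.arbitrary ι)⟩ hq.continuousOn
  set x : H := -((1 / 2 : ℝ) • v l) with hx
  have hvx : v l = -((2 : ℝ) • x) := by rw [hx]; module
  have hgap : ∀ y, ∑ i, l i * gap (p i) y = ‖y - x‖ ^ 2 + q l := by
    intro y
    have h1 : ∑ i, l i * gap (p i) y = ‖y‖ ^ 2 + inner ℝ y (v l) - c l := by
      simp only [gap_eq, v, c, inner_sum, real_inner_smul_right, mul_sub, mul_add,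
        Finset.sum_sub_distrib, Finset.sum_add_distrib, ← Finset.sum_mul, hl.2, one_mul]
    rw [h1]
    simp only [q, hvx, norm_sub_sq_real, norm_neg, norm_smul, inner_neg_right,
      real_inner_smul_right, Real.norm_ofNat]
    ring
  refine ⟨x, q l, ?_, ?_, ?_⟩
  · have h1 := sum_mul_inner_ge (fun i => (p i).1) (fun i => (p i).2) hmono hl
    have h2 : v l = (∑ i, l i • (p i).2) - ∑ i, l i • (p i).1 := by
      simp only [v, smul_sub, Finset.sum_sub_distrib]
    have h3 := norm_sub_sq_real (∑ i, l i • (p i).2) (∑ i, l i • (p i).1)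
    have h4 := norm_add_sq_real (∑ i, l i • (p i).2) (∑ i, l i • (p i).1)
    rw [← h2, real_inner_comm] at h3
    rw [real_inner_comm] at h4
    have h5 := sq_nonneg ‖(∑ i, l i • (p i).2) + ∑ i, l i • (p i).1‖
    simp only [q, c]
    linarith
  · intro j
    by_contra! hlt
    -- First-order optimality of `l` towards the vertex `j`: the slope of `q` in that direction is
    -- `gap (p j) x - q l`, and the second-order term is `-t ^ 2 * K`, with `K` as set below.
    have key : ∀ t : ℝ, 0 < t → t ≤ 1 →
        gap (p j) x - q l ≤ t * (‖(p j).2 - (p j).1 - v l‖ ^ 2 / 4) := by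
      intro t ht0 ht1
      let l' : ι → ℝ := (1 - t) • l + t • Pi.single j 1
      have hl' : l' ∈ stdSimplex ℝ ι :=
        (convex_stdSimplex ℝ ι) hl (single_mem_stdSimplex ℝ j) (by linarith) ht0.le (by ring)
      have hm : q l' ≤ q l := hmax hl'
      have hv' : v l' = v l + t • ((p j).2 - (p j).1 - v l) := by
        have : v l' = (1 - t) • v l + t • ((p j).2 - (p j).1) := by
          simp only [v, l', Pi.add_apply, Pi.smul_apply, smul_eq_mul, add_smul, mul_smul,
            Finset.sum_add_distrib, ← Finset.smul_sum]
          simp [Pi.single_apply]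
        rw [this]; module
      have hc' : c l' = c l + t * (inner ℝ (p j).1 (p j).2 - c l) := by
        have : c l' = (1 - t) * c l + t * inner ℝ (p j).1 (p j).2 := by
          simp only [c, l', Pi.add_apply, Pi.smul_apply, smul_eq_mul, add_mul, mul_assoc,
            Finset.sum_add_distrib, ← Finset.mul_sum]
          simp [Pi.single_apply]
        rw [this]; ring
      have hn : ‖v l'‖ ^ 2 = ‖v l‖ ^ 2 + 2 * (t * inner ℝ (v l) ((p j).2 - (p j).1 - v l))
          + t ^ 2 * ‖(p j).2 - (p j).1 - v l‖ ^ 2 := by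
        rw [hv', norm_add_sq_real, norm_smul, real_inner_smul_right, mul_pow, Real.norm_eq_abs,
          sq_abs]
      have hg : gap (p j) x - q l =
          -(inner ℝ (v l) ((p j).2 - (p j).1 - v l) / 2) - (inner ℝ (p j).1 (p j).2 - c l) := by
        rw [gap_eq]
        simp only [q, inner_sub_right, real_inner_self_eq_norm_sq, hx, norm_neg, norm_smul,
          inner_neg_left, real_inner_smul_left, one_div, norm_inv, Real.norm_ofNat]
        ring
      simp only [q, hn, hc'] at hm
      have hm' : t * (gap (p j) x - q l) ≤ t * (t * (‖(p j).2 - (p j).1 - v l‖ ^ 2 / 4)) := by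
        rw [hg]; nlinarith [hm]
      exact le_of_mul_le_mul_left hm' ht0
    set K := ‖(p j).2 - (p j).1 - v l‖ ^ 2 / 4 with hK
    have hK0 : 0 ≤ K := by positivity
    set d := gap (p j) x - q l with hd
    have hd0 : 0 < d := sub_pos.2 hlt
    have h := key (d / (d + K + 1)) (by positivity) ((div_le_one (by positivity)).2 (by linarith))
    rw [div_mul_eq_mul_div, le_div_iff₀ (by positivity)] at h
    nlinarith
  · intro y r' hy
    have : ∑ i, l i * gap (p i) y ≤ ∑ i, l i * r' :=
      Finset.sum_le_sum fun i _ => mul_le_mul_of_nonneg_left (hy i) (hl.1 i)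
    rw [hgap, ← Finset.sum_mul, hl.2, one_mul] at this
    linarith

/-- Any monotone relation has a common point of nonpositive gap. -/
lemma exists_forall_gap_nonpos [CompleteSpace H] (M : Set (H × H))
    (hM : ∀ p ∈ M, ∀ p' ∈ M, 0 ≤ inner ℝ (p.1 - p'.1) (p.2 - p'.2)) :
    ∃ x : H, ∀ p ∈ M, gap p x ≤ 0 := by
  classical
  rcases M.eq_empty_or_nonempty with rfl | ⟨p₀, hp₀⟩
  · exact ⟨0, by simp⟩
  let q₀ : M := ⟨p₀, hp₀⟩
  have hex : ∀ S : Finset M, ∃ (x : H) (r : ℝ), r ≤ 0 ∧ (∀ i ∈ insert q₀ S, gap i.1 x ≤ r) ∧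
      ∀ (y : H) (r' : ℝ), (∀ i ∈ insert q₀ S, gap i.1 y ≤ r') → r + ‖y - x‖ ^ 2 ≤ r' := by
    intro S
    have : Nonempty (insert q₀ S : Finset M) := ⟨⟨q₀, Finset.mem_insert_self _ _⟩⟩
    obtain ⟨x, r, h0, h1, h2⟩ := exists_minimax_gap
      (fun i : (insert q₀ S : Finset M) => (i.1.1 : H × H))
      (fun i j => hM _ i.1.2 _ j.1.2)
    exact ⟨x, r, h0, fun i hi => h1 ⟨i, hi⟩, fun y r' hy => h2 y r' fun i => hy i.1 i.2⟩
  choose x r h0 h1 h2 using hex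
  -- Quadratic growth lets the bounded monotone net `r` control the net `x`, so `x` is Cauchy.
  have hstep : ∀ S S' : Finset M, S ≤ S' → r S + ‖x S' - x S‖ ^ 2 ≤ r S' := fun S S' hS =>
    h2 S _ _ fun i hi => h1 S' i (Finset.insert_subset_insert _ hS hi)
  have hr : Monotone r := fun S S' hS => by nlinarith [hstep S S' hS, sq_nonneg ‖x S' - x S‖]
  have hrc : CauchySeq r :=
    (tendsto_atTop_ciSup hr ⟨0, by rintro _ ⟨S, rfl⟩; exact h0 S⟩).cauchySeq
  have hxc : CauchySeq x := by
    rw [Metric.cauchySeq_iff']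
    intro ε hε
    obtain ⟨N, hN⟩ := Metric.cauchySeq_iff'.1 hrc (ε ^ 2) (by positivity)
    refine ⟨N, fun n hn => ?_⟩
    have h3 := hN n hn
    rw [Real.dist_eq] at h3
    have h4 := hstep N n hn
    rw [dist_eq_norm]
    refine lt_of_pow_lt_pow_left₀ 2 hε.le ?_
    linarith [le_abs_self (r n - r N)]
  obtain ⟨y, hy⟩ := cauchySeq_tendsto_of_complete hxc
  refine ⟨y, fun p hp => ?_⟩
  have hcont : Continuous (gap p) := by unfold gap; fun_prop
  refine le_of_tendsto ((hcont.tendsto y).comp hy) ?_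
  filter_upwards [eventually_ge_atTop ({⟨p, hp⟩} : Finset M)] with S hS
  exact (h1 S ⟨p, hp⟩ (Finset.mem_insert_of_mem (hS (Finset.mem_singleton_self _)))).trans (h0 S)

end MonotoneRelation

/-! ### Minty's theorem and Lipschitz perturbations -/

namespace SetOp

variable {H : Type*} [NormedAddCommGroup H] [InnerProductSpace ℝ H]

/-- Otherwise adjoining `(x, v)` to the graph would give a proper monotone extension. -/
lemma IsMaximalMonotone.mem_of_forall {A : H → Set H} (hA : IsMaximalMonotone A) {x v : H}
    (h : ∀ a b, b ∈ A a → 0 ≤ inner ℝ (x - a) (v - b)) : v ∈ A x := by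
  by_contra hv
  let S : H → Set H := fun y => {b | b ∈ A y ∨ (y = x ∧ b = v)}
  have hS : IsMonotone S := by
    rintro y y' b b' (hb | ⟨rfl, rfl⟩) (hb' | ⟨rfl, rfl⟩)
    · exact hA.1 _ _ _ _ hb hb'
    · have := h _ _ hb
      rwa [← neg_sub y, ← neg_sub b, inner_neg_neg] at this
    · exact h _ _ hb'
    · simp
  refine hA.2 S hS ⟨fun p hp => Or.inl hp, fun hsub => hv ?_⟩
  exact hsub (show (x, v) ∈ graph S from Or.inr ⟨rfl, rfl⟩)

/-- Minty's theorem: the resolvent of a maximal monotone operator is everywhere defined. -/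
lemma IsMaximalMonotone.exists_add_smul_eq [CompleteSpace H] {A : H → Set H}
    (hA : IsMaximalMonotone A) {τ : ℝ} (hτ : 0 < τ) (s : H) :
    ∃ x, ∃ a ∈ A x, x + τ • a = s := by
  -- With second components `τ • a - s`, a nonpositive gap says that `(x, τ⁻¹ • (s - x))` is
  -- monotonically related to the graph of `A`.
  obtain ⟨x, hx⟩ := MonotoneRelation.exists_forall_gap_nonpos
    {p : H × H | ∃ a ∈ A p.1, p.2 = τ • a - s} (by
      rintro ⟨y, _⟩ ⟨b, hb, rfl⟩ ⟨y', _⟩ ⟨b', hb', rfl⟩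
      have : τ • b - s - (τ • b' - s) = τ • (b - b') := by module
      simp only [this, real_inner_smul_right]
      exact mul_nonneg hτ.le (hA.1 _ _ _ _ hb hb'))
  refine ⟨x, τ⁻¹ • (s - x), hA.mem_of_forall fun a b hb => ?_, ?_⟩
  · have h := hx (a, τ • b - s) ⟨b, hb, rfl⟩
    have e : τ⁻¹ • (s - x) - b = -(τ⁻¹ • (x + (τ • b - s))) := by
      rw [smul_add, smul_sub, smul_sub, smul_smul, inv_mul_cancel₀ hτ.ne']
      module
    rw [e, inner_neg_right, real_inner_smul_right]
    have := mul_nonneg (inv_pos.2 hτ).le (neg_nonneg.2 h)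
    simp only [MonotoneRelation.gap] at this
    linarith
  · rw [smul_smul, mul_inv_cancel₀ hτ.ne']; module

lemma IsMonotone.norm_sub_le_of_add_smul_eq {A : H → Set H} (hA : IsMonotone A) {τ : ℝ}
    (hτ : 0 < τ) {x x' a a' s s' : H} (ha : a ∈ A x) (ha' : a' ∈ A x') (h : x + τ • a = s)
    (h' : x' + τ • a' = s') : ‖x - x'‖ ≤ ‖s - s'‖ := by
  have h1 := mul_nonneg hτ.le (hA _ _ _ _ ha ha')
  have h2 : s - s' = (x - x') + τ • (a - a') := by rw [← h, ← h']; module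
  have h3 : ‖x - x'‖ ^ 2 ≤ ‖s - s'‖ ^ 2 := by
    rw [h2, norm_add_sq_real, real_inner_smul_right]
    nlinarith [sq_nonneg ‖τ • (a - a')‖]
  exact le_of_sq_le_sq h3 (norm_nonneg _)

/-- Surjectivity of `I + ρ (A + F)` for `A` maximal monotone and `F` monotone and Lipschitz. -/
lemma IsMaximalMonotone.exists_add_smul_add_eq [CompleteSpace H] {A : H → Set H}
    (hA : IsMaximalMonotone A) {F : H → H} {K : ℝ≥0} (hFmono : IsMonotone (ofFun F))
    (hFlip : LipschitzWith K F) {ρ : ℝ} (hρ : 0 < ρ) (s : H) :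
    ∃ x, ∃ a ∈ A x, x + ρ • (a + F x) = s := by
  set N : ℝ := 1 + ρ * K with hN
  have hN1 : 1 ≤ N := by have : 0 ≤ ρ * K := by positivity
                         linarith
  -- `N` is a Lipschitz constant of the strongly monotone map `I + ρF`. This `τ` minimizes the
  -- squared contraction factor bound `1 - 2τ + τ ^ 2 * N ^ 2`, though only `1 - τ` is used.
  set τ : ℝ := 1 / N ^ 2 with hτdef
  have hτ : 0 < τ := by positivity
  have hτN : τ * N ^ 2 = 1 := by rw [hτdef]; field_simp
  have hτ1 : τ ≤ 1 := by
    rw [hτdef, div_le_one (by positivity)]; nlinarith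
  choose J a ha hJ using hA.exists_add_smul_eq (mul_pos hτ hρ)
  -- Forward-backward map: an explicit step of length `τ` on `I + ρF - s`, then the resolvent of
  -- `τρA`. Its fixed points solve the inclusion.
  let Φ : H → H := fun x => J (x - τ • (x + ρ • F x - s))
  have hdist : ∀ x y, ‖Φ x - Φ y‖ ^ 2 ≤ (1 - τ) * ‖x - y‖ ^ 2 := by
    intro x y
    have h1 : ‖Φ x - Φ y‖ ≤ ‖x - τ • (x + ρ • F x - s) - (y - τ • (y + ρ • F y - s))‖ :=
      hA.1.norm_sub_le_of_add_smul_eq (mul_pos hτ hρ) (ha _) (ha _) (hJ _) (hJ _)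
    set g := (x - y) + ρ • (F x - F y) with hg
    have e : x - τ • (x + ρ • F x - s) - (y - τ • (y + ρ • F y - s)) = (x - y) - τ • g := by
      rw [hg]; module
    have h2 : ‖x - y‖ ^ 2 ≤ inner ℝ (x - y) g := by
      rw [hg, inner_add_right, real_inner_self_eq_norm_sq, real_inner_smul_right]
      have := mul_nonneg hρ.le (hFmono x y (F x) (F y) rfl rfl)
      linarith
    have h3 : ‖g‖ ≤ N * ‖x - y‖ := by
      calc ‖g‖ ≤ ‖x - y‖ + ‖ρ • (F x - F y)‖ := norm_add_le _ _
        _ = ‖x - y‖ + ρ * ‖F x - F y‖ := by rw [norm_smul, Real.norm_of_nonneg hρ.le]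
        _ ≤ ‖x - y‖ + ρ * (K * ‖x - y‖) := by
            gcongr; simpa only [dist_eq_norm] using hFlip.dist_le_mul x y
        _ = _ := by rw [hN]; ring
    have h4 : ‖(x - y) - τ • g‖ ^ 2 ≤ (1 - τ) * ‖x - y‖ ^ 2 := by
      rw [norm_sub_sq_real, real_inner_smul_right, norm_smul, Real.norm_of_nonneg hτ.le, mul_pow]
      have h5 : ‖g‖ ^ 2 ≤ N ^ 2 * ‖x - y‖ ^ 2 := by
        rw [← mul_pow]; exact pow_le_pow_left₀ (norm_nonneg _) h3 2
      have h6 : τ ^ 2 * ‖g‖ ^ 2 ≤ τ * ‖x - y‖ ^ 2 := by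
        calc τ ^ 2 * ‖g‖ ^ 2 ≤ τ ^ 2 * (N ^ 2 * ‖x - y‖ ^ 2) := by gcongr
          _ = τ * (τ * N ^ 2) * ‖x - y‖ ^ 2 := by ring
          _ = _ := by rw [hτN, mul_one]
      have h7 := mul_le_mul_of_nonneg_left h2 hτ.le
      linarith
    rw [e] at h1
    exact (pow_le_pow_left₀ (norm_nonneg _) h1 2).trans h4
  have hcontr : ContractingWith (Real.toNNReal √(1 - τ)) Φ := by
    constructor
    · rw [← NNReal.coe_lt_coe, Real.coe_toNNReal _ (Real.sqrt_nonneg _), NNReal.coe_one,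
        Real.sqrt_lt' one_pos]
      linarith
    · refine LipschitzWith.of_dist_le_mul fun x y => ?_
      rw [Real.coe_toNNReal _ (Real.sqrt_nonneg _), dist_eq_norm, dist_eq_norm]
      refine le_of_sq_le_sq ?_ (by positivity)
      rw [mul_pow, Real.sq_sqrt (by linarith)]
      exact hdist x y
  set x := hcontr.fixedPoint Φ
  have hx : J (x - τ • (x + ρ • F x - s)) = x := hcontr.fixedPoint_isFixedPt
  have h1 := ha (x - τ • (x + ρ • F x - s))
  have h2 := hJ (x - τ • (x + ρ • F x - s))
  rw [hx] at h1 h2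
  refine ⟨x, _, h1, ?_⟩
  set b := a (x - τ • (x + ρ • F x - s))
  have h3 : τ • (x + ρ • (b + F x) - s) = 0 := by
    have : τ • (x + ρ • (b + F x) - s) =
      (x + (τ * ρ) • b) - (x - τ • (x + ρ • F x - s)) := by module
    rw [this, h2, sub_self]
  exact sub_eq_zero.1 ((smul_eq_zero.1 h3).resolve_left hτ.ne')

end SetOp

/-! ### Linearization of `D` and dependence of the resolvent on `ρ` -/

namespace SetOp

variable {H : Type*} [NormedAddCommGroup H] [InnerProductSpace ℝ H]

/-- The inner product is the derivative at `0` of the nondecreasing real function `t ↦ ⟪h, D (u + t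
• h)⟫`. -/
lemma IsMonotone.inner_fderiv_nonneg {D : H → H} (hD : IsMonotone (ofFun D)) {u : H}
    (hdiff : DifferentiableAt ℝ D u) (h : H) : 0 ≤ inner ℝ h (fderiv ℝ D u h) := by
  let g : ℝ → ℝ := fun t => inner ℝ h (D (u + t • h))
  have hg : HasDerivAt g (inner ℝ h (fderiv ℝ D u h)) 0 := by
    have h1 : HasDerivAt (fun t : ℝ => D (u + t • h)) (fderiv ℝ D u h) 0 :=
      hdiff.hasFDerivAt.hasLineDerivAt h
    simpa using (hasDerivAt_const (0 : ℝ) h).inner ℝ h1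
  have hmono : Monotone g := by
    intro t t' htt
    rcases htt.eq_or_lt with rfl | hlt
    · exact le_rfl
    have h1 := hD (u + t' • h) (u + t • h) _ _ rfl rfl
    have e : u + t' • h - (u + t • h) = (t' - t) • h := by module
    rw [e, real_inner_smul_left, inner_sub_right] at h1
    have := nonneg_of_mul_nonneg_right h1 (sub_pos.2 hlt)
    simp only [g]
    linarith
  rw [← hg.deriv]
  exact hmono.deriv_nonneg

lemma isMonotone_linearization {D : H → H} (hD : IsMonotone (ofFun D)) {u : H}
    (hdiff : DifferentiableAt ℝ D u) : IsMonotone (ofFun (linearization D u)) := by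
  rintro x y _ _ rfl rfl
  have e : linearization D u x - linearization D u y = fderiv ℝ D u (x - y) := by
    simp only [linearization, map_sub]; abel
  rw [e]
  exact hD.inner_fderiv_nonneg hdiff _

lemma lipschitzWith_linearization (D : H → H) (u : H) :
    LipschitzWith ‖fderiv ℝ D u‖₊ (linearization D u) := by
  refine LipschitzWith.of_dist_le_mul fun x y => ?_
  have e : linearization D u x - linearization D u y = fderiv ℝ D u (x - y) := by
    simp only [linearization, map_sub]; abel
  rw [dist_eq_norm, dist_eq_norm, e]
  exact (fderiv ℝ D u).le_opNorm _

lemma IsMonotone.add_ofFun {A : H → Set H} {F : H → H} (hA : IsMonotone A)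
    (hF : IsMonotone (ofFun F)) : IsMonotone (A + ofFun F) := by
  rintro x y _ _ ⟨a, ha, b, hb, rfl⟩ ⟨a', ha', b', hb', rfl⟩
  have := add_nonneg (hA _ _ _ _ ha ha') (hF _ _ _ _ hb hb')
  rwa [← inner_add_right, sub_add_sub_comm] at this

lemma mem_resolvent_smul {T : H → Set H} {ρ : ℝ} {s x : H} :
    x ∈ resolvent (ρ • T) s ↔ ∃ v ∈ T x, x + ρ • v = s := by
  constructor
  · rintro ⟨_, ⟨v, hv, rfl⟩, _, rfl, rfl⟩
    exact ⟨v, hv, add_comm _ _⟩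
  · rintro ⟨v, hv, rfl⟩
    exact ⟨ρ • v, ⟨v, hv, rfl⟩, x, rfl, add_comm _ _⟩

/-- The resolvent of the sum of a maximal monotone operator and a monotone Lipschitz map is
single-valued and everywhere defined. -/
lemma IsMaximalMonotone.exists_resolvent_add_eq_singleton [CompleteSpace H] {A : H → Set H}
    (hA : IsMaximalMonotone A) {F : H → H} {K : ℝ≥0} (hFmono : IsMonotone (ofFun F))
    (hFlip : LipschitzWith K F) {ρ : ℝ} (hρ : 0 < ρ) (s : H) :
    ∃ x, resolvent (ρ • (A + ofFun F)) s = {x} := by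
  obtain ⟨x, a, ha, hx⟩ := hA.exists_add_smul_add_eq hFmono hFlip hρ s
  have hv : a + F x ∈ (A + ofFun F) x := ⟨a, ha, F x, rfl, rfl⟩
  refine ⟨x, Set.eq_singleton_iff_unique_mem.2 ⟨mem_resolvent_smul.2 ⟨_, hv, hx⟩, fun y hy => ?_⟩⟩
  obtain ⟨v, hv', hy⟩ := mem_resolvent_smul.1 hy
  have := (hA.1.add_ofFun hFmono).norm_sub_le_of_add_smul_eq hρ hv' hv hy hx
  rw [sub_self, norm_zero] at this
  exact sub_eq_zero.1 (norm_le_zero_iff.1 this)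

/-- If `(1/ρ)(u - x)` and `(1/ρ')(u - x')` are, up to a common shift, values of a monotone operator
at `x` and `x'`, then `‖x - u‖` increases with `ρ`, while `‖x - u‖ / ρ` decreases. -/
lemma IsMonotone.norm_sub_le_and_mul_norm_sub_le {T : H → Set H} (hT : IsMonotone T)
    {u e x x' v v' : H} {ρ ρ' : ℝ} (hρ : 0 < ρ) (hρρ : ρ ≤ ρ') (hv : v ∈ T x) (hv' : v' ∈ T x')
    (hx : x + ρ • v = u + ρ • e) (hx' : x' + ρ' • v' = u + ρ' • e) :
    ‖x - u‖ ≤ ‖x' - u‖ ∧ ρ * ‖x' - u‖ ≤ ρ' * ‖x - u‖ := by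
  have hρ' : 0 < ρ' := hρ.trans_le hρρ
  have h1 : ρ • (v - e) = -(x - u) := by
    have : ρ • (v - e) = (x + ρ • v) - x - ρ • e := by module
    rw [this, hx]; module
  have h1' : ρ' • (v' - e) = -(x' - u) := by
    have : ρ' • (v' - e) = (x' + ρ' • v') - x' - ρ' • e := by module
    rw [this, hx']; module
  have h2 := mul_nonneg (mul_pos hρ hρ').le (hT _ _ _ _ hv hv')
  have e1 : (ρ * ρ') • (v - v') = ρ • (x' - u) - ρ' • (x - u) := by
    have : (ρ * ρ') • (v - v') = ρ' • (ρ • (v - e)) - ρ • (ρ' • (v' - e)) := by module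
    rw [this, h1, h1']; module
  have e2 : x - x' = (x - u) - (x' - u) := by abel
  rw [← real_inner_smul_right, e1, e2] at h2
  generalize x - u = p at *
  generalize x' - u = p' at *
  have hcs := real_inner_le_norm p p'
  simp only [inner_sub_left, inner_sub_right, real_inner_smul_right, real_inner_self_eq_norm_sq,
    real_inner_comm p p'] at h2
  -- Cauchy-Schwarz makes monotonicity factor. Since `ρ ≤ ρ'`, a failure of either claimed
  -- inequality would give the two factors opposite signs.
  have h3 : 0 ≤ (‖p‖ - ‖p'‖) * (ρ * ‖p'‖ - ρ' * ‖p‖) := by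
    have := mul_le_mul_of_nonneg_left hcs (add_pos hρ hρ').le
    nlinarith
  have hp := norm_nonneg p
  have hp' := norm_nonneg p'
  constructor
  · by_contra! hlt
    have := nonneg_of_mul_nonneg_right h3 (sub_pos.2 hlt)
    nlinarith
  · by_contra! hlt
    have := nonneg_of_mul_nonneg_left h3 (sub_pos.2 hlt)
    nlinarith

end SetOp

/-! ### Growth of `ψ`, brackets and termination of the procedure -/

namespace BBData

open SetOp

variable {H : Type*} [NormedAddCommGroup H] [InnerProductSpace ℝ H] {P : BBData H}

lemma IsProxPoint.unique {ρ : ℝ} {x y : H} (hx : P.IsProxPoint ρ x) (hy : P.IsProxPoint ρ y) :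
    x = y :=
  Set.singleton_injective (hx.symm.trans hy)

lemma IsProxPoint.norm_sub_le_and_mul_norm_sub_le
    (hT : IsMonotone (P.A + ofFun (linearization P.D (P.G P.z)))) {ρ ρ' : ℝ} {x x' : H}
    (hρ : 0 < ρ) (hρρ : ρ ≤ ρ') (hx : P.IsProxPoint ρ x) (hx' : P.IsProxPoint ρ' x') :
    ‖x - P.G P.z‖ ≤ ‖x' - P.G P.z‖ ∧ ρ * ‖x' - P.G P.z‖ ≤ ρ' * ‖x - P.G P.z‖ := by
  obtain ⟨v, hv, h⟩ := mem_resolvent_smul.1 (hx.symm ▸ Set.mem_singleton x)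
  obtain ⟨v', hv', h'⟩ := mem_resolvent_smul.1 (hx'.symm ▸ Set.mem_singleton x')
  rw [add_sub_assoc, ← smul_sub] at h h'
  exact hT.norm_sub_le_and_mul_norm_sub_le hρ hρρ hv hv' h h'

lemma psi_pos (hδ : 0 < P.δ) {ρ : ℝ} (hρ : 0 < ρ) (x : H) : 0 < P.psi ρ x := by
  have := mul_pos (add_pos_of_nonneg_of_pos (ENNReal.toReal_nonneg (a := P.β⁻¹)) hδ) hρ
  unfold psi
  positivity

/-- `ψ(ρ) / ρ` increases with `ρ`. -/
lemma IsProxPoint.mul_psi_le (hT : IsMonotone (P.A + ofFun (linearization P.D (P.G P.z))))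
    {ρ ρ' : ℝ} {x x' : H} (hρ : 0 < ρ) (hρρ : ρ ≤ ρ')
    (hx : P.IsProxPoint ρ x) (hx' : P.IsProxPoint ρ' x') :
    ρ' * P.psi ρ x ≤ ρ * P.psi ρ' x' := by
  have hρ' := hρ.trans_le hρρ
  have h1 := (hx.norm_sub_le_and_mul_norm_sub_le hT hρ hρρ hx').1
  have h2 : 4 * (P.ℓ : ℝ) ^ 2 * ρ + P.m ^ 2 * ρ * ‖x - P.G P.z‖ ^ 2 ≤
      4 * (P.ℓ : ℝ) ^ 2 * ρ' + P.m ^ 2 * ρ' * ‖x' - P.G P.z‖ ^ 2 := by gcongr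
  have h3 := mul_le_mul_of_nonneg_left h2 (mul_pos hρ hρ').le
  unfold psi
  linarith

/-- `ψ(ρ) / ρ ^ 4` decreases with `ρ`. -/
lemma IsProxPoint.psi_le_div_pow_mul (hT : IsMonotone (P.A + ofFun (linearization P.D (P.G P.z))))
    (hδ : 0 < P.δ) {ρ ρ' : ℝ} {x x' : H} (hρ : 0 < ρ) (hρρ : ρ ≤ ρ')
    (hx : P.IsProxPoint ρ x) (hx' : P.IsProxPoint ρ' x') :
    P.psi ρ' x' ≤ (ρ' / ρ) ^ 4 * P.psi ρ x := by
  have h1 := (hx.norm_sub_le_and_mul_norm_sub_le hT hρ hρρ hx').2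
  set κ := ρ' / ρ with hκ
  have hκ1 : 1 ≤ κ := (one_le_div hρ).2 hρρ
  have hρ' : ρ' = κ * ρ := by rw [hκ]; field_simp
  have h2 : ‖x' - P.G P.z‖ ≤ κ * ‖x - P.G P.z‖ := by
    refine le_of_mul_le_mul_left ?_ hρ
    rw [hρ'] at h1; linarith
  have hc : 0 ≤ ((P.β⁻¹).toReal + P.δ) * ρ :=
    mul_nonneg (add_nonneg ENNReal.toReal_nonneg hδ.le) hρ.le
  have k2 : κ ^ 2 ≤ κ ^ 4 := pow_le_pow_right₀ hκ1 (by norm_num)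
  have k1 : κ ≤ κ ^ 4 := le_self_pow₀ hκ1 (by norm_num)
  have t1 : 4 * (P.ℓ : ℝ) ^ 2 * ρ' ^ 2 ≤ κ ^ 4 * (4 * (P.ℓ : ℝ) ^ 2 * ρ ^ 2) := by
    rw [hρ', mul_pow, mul_left_comm]; gcongr
  have t2 : ((P.β⁻¹).toReal + P.δ) * ρ' ≤ κ ^ 4 * (((P.β⁻¹).toReal + P.δ) * ρ) := by
    rw [hρ', mul_left_comm]; gcongr
  have t3 : ((P.m : ℝ) * ρ' * ‖x' - P.G P.z‖) ^ 2 ≤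
      κ ^ 4 * ((P.m : ℝ) * ρ * ‖x - P.G P.z‖) ^ 2 := by
    calc ((P.m : ℝ) * ρ' * ‖x' - P.G P.z‖) ^ 2
        ≤ ((P.m : ℝ) * ρ' * (κ * ‖x - P.G P.z‖)) ^ 2 := by
          have := hρ.trans_le hρρ
          gcongr
      _ = _ := by rw [hρ']; ring
  unfold psi
  linarith

variable (P) in
/-- The bracket `[tlo, thi]` has the window of `ψ` between its end points. -/
structure IsBracket (tlo thi : ℝ) : Prop where
  pos : 0 < tlo
  lt : tlo < thi
  psi_le : ∀ x, P.IsProxPoint tlo x → P.psi tlo x ≤ P.θlo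
  le_psi : ∀ x, P.IsProxPoint thi x → P.θhi ≤ P.psi thi x

lemma IsBracket.lt_sqrt {tlo thi : ℝ} (h : P.IsBracket tlo thi) : tlo < √(tlo * thi) :=
  Real.lt_sqrt_of_sq_lt (by nlinarith [h.pos, h.lt])

lemma IsBracket.sqrt_lt {tlo thi : ℝ} (h : P.IsBracket tlo thi) : √(tlo * thi) < thi := by
  have h0 := h.pos.trans h.lt
  rw [Real.sqrt_lt' h0]
  nlinarith [h.lt]

lemma IsBracket.sqrt_pos {tlo thi : ℝ} (h : P.IsBracket tlo thi) : 0 < √(tlo * thi) :=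
  h.pos.trans h.lt_sqrt

/-- What is known of the configurations that can be reached. -/
def IsValid (P : BBData H) : BBState H → Prop
  | .init ρ => 0 < ρ
  | .bisect tlo thi => P.IsBracket tlo thi
  | .ret ρ x y => 0 < ρ ∧ P.IsProxPoint ρ x ∧ P.θlo ≤ P.psi ρ x ∧ P.psi ρ x ≤ P.θhi ∧
      y = P.yOut ρ x

/-- Only the bracketing phase needs an argument: the new end point is where the linear function
through the origin and `(ρ, ψ(ρ))` reaches the far side of the window, and `ψ(ρ) / ρ` is
nondecreasing. -/
lemma Step.isValid (hT : IsMonotone (P.A + ofFun (linearization P.D (P.G P.z))))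
    (hδ : 0 < P.δ) (hθlo : 0 < P.θlo) (hθ : P.θlo < P.θhi) {σ σ' : BBState H}
    (h : P.Step σ σ') (hσ : P.IsValid σ) : P.IsValid σ' := by
  cases h with
  | init_ret ρ x hx h1 h2 => exact ⟨hσ, hx, h1, h2, rfl⟩
  | init_lt ρ x hx h1 =>
    have hρ : 0 < ρ := hσ
    have h0 := psi_pos hδ hρ x
    have hlt : ρ < ρ * P.θhi / P.psi ρ x := by
      rw [lt_div_iff₀ h0]; exact mul_lt_mul_of_pos_left (h1.trans hθ) hρ
    refine ⟨hρ, hlt, fun y hy => hy.unique hx ▸ h1.le, fun y hy => ?_⟩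
    have h2 := hx.mul_psi_le hT hρ hlt.le hy
    rw [div_mul_cancel₀ _ h0.ne'] at h2
    exact le_of_mul_le_mul_left h2 hρ
  | init_gt ρ x hx h1 =>
    have hρ : 0 < ρ := hσ
    have h0 := psi_pos hδ hρ x
    have hlt : ρ * P.θlo / P.psi ρ x < ρ := by
      rw [div_lt_iff₀ h0]; exact mul_lt_mul_of_pos_left (hθ.trans h1) hρ
    have hpos : 0 < ρ * P.θlo / P.psi ρ x := by positivity
    refine ⟨hpos, hlt, fun y hy => ?_, fun y hy => hy.unique hx ▸ h1.le⟩
    have h2 := hy.mul_psi_le hT hpos hlt.le hx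
    rw [div_mul_cancel₀ _ h0.ne'] at h2
    exact le_of_mul_le_mul_left h2 hρ
  | bisect_ret tlo thi x hx h1 h2 => exact ⟨IsBracket.sqrt_pos hσ, hx, h1, h2, rfl⟩
  | bisect_gt tlo thi x hx h1 =>
    exact ⟨hσ.pos, IsBracket.lt_sqrt hσ, hσ.psi_le, fun y hy => hy.unique hx ▸ h1.le⟩
  | bisect_lt tlo thi x hx h1 =>
    exact ⟨IsBracket.sqrt_pos hσ, IsBracket.sqrt_lt hσ, fun y hy => hy.unique hx ▸ h1.le,
      hσ.le_psi⟩

lemma Step.right_unique (hθ : P.θlo < P.θhi) : Relator.RightUnique P.Step := by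
  intro σ τ τ' h h'
  cases h with
  | init_ret ρ x hx =>
    cases h' with | _ ρ x' hx' => cases hx.unique hx'; first | rfl | linarith
  | init_lt ρ x hx =>
    cases h' with | _ ρ x' hx' => cases hx.unique hx'; first | rfl | linarith
  | init_gt ρ x hx =>
    cases h' with | _ ρ x' hx' => cases hx.unique hx'; first | rfl | linarith
  | bisect_ret tlo thi x hx =>
    cases h' with | _ tlo thi x' hx' => cases hx.unique hx'; first | rfl | linarith
  | bisect_gt tlo thi x hx =>
    cases h' with | _ tlo thi x' hx' => cases hx.unique hx'; first | rfl | linarith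
  | bisect_lt tlo thi x hx =>
    cases h' with | _ tlo thi x' hx' => cases hx.unique hx'; first | rfl | linarith

lemma not_step_ret {ρ : ℝ} {x y : H} {σ : BBState H} : ¬ P.Step (.ret ρ x y) σ := nofun

/-- A valid configuration that is not final can be continued. -/
lemma IsValid.exists_step (hprox : ∀ ρ, 0 < ρ → ∃ x, P.IsProxPoint ρ x) {σ : BBState H}
    (hσ : P.IsValid σ) (hret : ∀ ρ x y, σ ≠ .ret ρ x y) : ∃ σ', P.Step σ σ' := by
  cases σ with
  | init ρ =>
    obtain ⟨x, hx⟩ := hprox ρ hσ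
    rcases lt_or_ge (P.psi ρ x) P.θlo with h1 | h1
    · exact ⟨_, .init_lt ρ x hx h1⟩
    rcases lt_or_ge P.θhi (P.psi ρ x) with h2 | h2
    · exact ⟨_, .init_gt ρ x hx h2⟩
    · exact ⟨_, .init_ret ρ x hx h1 h2⟩
  | bisect tlo thi =>
    obtain ⟨x, hx⟩ := hprox _ (IsBracket.sqrt_pos hσ)
    rcases lt_or_ge (P.psi √(tlo * thi) x) P.θlo with h1 | h1
    · exact ⟨_, .bisect_lt tlo thi x hx h1⟩
    rcases lt_or_ge P.θhi (P.psi √(tlo * thi) x) with h2 | h2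
    · exact ⟨_, .bisect_gt tlo thi x hx h2⟩
    · exact ⟨_, .bisect_ret tlo thi x hx h1 h2⟩
  | ret ρ x y => exact absurd rfl (hret ρ x y)

/-- A pass through the loop that does not return takes the square root of `thi / tlo`. -/
lemma Step.exists_bisect {tlo thi : ℝ} (hb : P.IsBracket tlo thi) {σ σ' : BBState H}
    (h : P.Step (.bisect tlo thi) σ) (h' : P.Step σ σ') :
    ∃ tlo' thi', σ = .bisect tlo' thi' ∧ (thi' / tlo') ^ 2 = thi / tlo := by
  have hlo := hb.pos
  have hhi := hb.pos.trans hb.lt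
  have hsq : √(tlo * thi) ^ 2 = tlo * thi := Real.sq_sqrt (mul_pos hlo hhi).le
  cases h with
  | bisect_ret x => exact absurd h' not_step_ret
  | bisect_gt x => exact ⟨_, _, rfl, by rw [div_pow, hsq]; field_simp⟩
  | bisect_lt x => exact ⟨_, _, rfl, by rw [div_pow, hsq]; field_simp⟩

/-- In a bracket the ratio `thi / tlo` is bounded away from `1`. -/
lemma IsBracket.div_le_pow (hT : IsMonotone (P.A + ofFun (linearization P.D (P.G P.z))))
    (hprox : ∀ ρ, 0 < ρ → ∃ x, P.IsProxPoint ρ x) (hδ : 0 < P.δ) (hθlo : 0 < P.θlo)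
    {tlo thi : ℝ} (hb : P.IsBracket tlo thi) : P.θhi / P.θlo ≤ (thi / tlo) ^ 4 := by
  obtain ⟨x, hx⟩ := hprox tlo hb.pos
  obtain ⟨x', hx'⟩ := hprox thi (hb.pos.trans hb.lt)
  rw [div_le_iff₀ hθlo]
  have := hx.psi_le_div_pow_mul hT hδ hb.pos hb.lt.le hx'
  exact (hb.le_psi x' hx').trans (this.trans
    (mul_le_mul_of_nonneg_left (hb.psi_le x hx) (Even.pow_nonneg (by decide) _)))

lemma not_exists_infinite_execution
    (hT : IsMonotone (P.A + ofFun (linearization P.D (P.G P.z))))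
    (hprox : ∀ ρ, 0 < ρ → ∃ x, P.IsProxPoint ρ x) (hδ : 0 < P.δ) (hθlo : 0 < P.θlo)
    (hθ : P.θlo < P.θhi) {ρ₀ : ℝ} (hρ₀ : 0 < ρ₀) :
    ¬ ∃ s : ℕ → BBState H, s 0 = .init ρ₀ ∧ ∀ k, P.Step (s k) (s (k + 1)) := by
  rintro ⟨s, hs0, hs⟩
  have hvalid : ∀ k, P.IsValid (s k) := by
    intro k
    induction k with
    | zero => rw [hs0]; exact hρ₀
    | succ k ih => exact (hs k).isValid hT hδ hθlo hθ ih
  -- `κ` is the ratio of the first bracket. That bracket is `s 1`, since `s 0` is the initial state;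
  -- hence the shift between index and exponent.
  obtain ⟨κ, hκ⟩ : ∃ κ : ℝ, ∀ k, ∃ tlo thi, s (k + 1) = .bisect tlo thi ∧
      (thi / tlo) ^ 2 ^ k = κ := by
    obtain ⟨a, b, hab⟩ : ∃ a b, s 1 = .bisect a b := by
      have h0 := hs 0
      have h1 := hs 1
      rw [hs0] at h0
      revert h0 h1
      generalize s 1 = σ
      intro h0 h1
      cases h0 with
      | init_ret x => exact absurd h1 not_step_ret
      | init_lt x => exact ⟨_, _, rfl⟩
      | init_gt x => exact ⟨_, _, rfl⟩
    refine ⟨b / a, fun k => ?_⟩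
    induction k with
    | zero => exact ⟨a, b, hab, by simp⟩
    | succ k ih =>
      obtain ⟨tlo, thi, h1, h2⟩ := ih
      have hb := hvalid (k + 1)
      have h3 := hs (k + 1)
      rw [h1] at hb h3
      obtain ⟨tlo', thi', h4, h5⟩ := h3.exists_bisect hb (hs (k + 2))
      exact ⟨tlo', thi', h4, by rw [pow_succ', pow_mul, h5, h2]⟩
  have hc : 1 < P.θhi / P.θlo := (one_lt_div hθlo).2 hθ
  -- Raising the bracket bound to the power `2 ^ n` gives `(θhi / θlo) ^ 2 ^ n ≤ κ ^ 4`; as `n < 2 ^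
  -- n`, this `n` contradicts it.
  obtain ⟨n, hn⟩ := pow_unbounded_of_one_lt (κ ^ 4) hc
  obtain ⟨tlo, thi, h1, h2⟩ := hκ n
  have hb := hvalid (n + 1)
  rw [h1] at hb
  have h3 : (P.θhi / P.θlo) ^ 2 ^ n ≤ κ ^ 4 := by
    rw [← h2, ← pow_mul, mul_comm, pow_mul]
    exact pow_le_pow_left₀ (zero_le_one.trans hc.le) (IsBracket.div_le_pow hT hprox hδ hθlo hb) _
  have h4 : (P.θhi / P.θlo) ^ n ≤ (P.θhi / P.θlo) ^ 2 ^ n :=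
    pow_le_pow_right₀ hc.le Nat.lt_two_pow_self.le
  linarith

lemma Reaches.isValid (hT : IsMonotone (P.A + ofFun (linearization P.D (P.G P.z))))
    (hδ : 0 < P.δ) (hθlo : 0 < P.θlo) (hθ : P.θlo < P.θhi) {σ σ' : BBState H}
    (h : P.Reaches σ σ') (hσ : P.IsValid σ) : P.IsValid σ' := by
  induction h with
  | refl => exact hσ
  | tail _ hstep ih => exact hstep.isValid hT hδ hθlo hθ ih

lemma exists_reaches_ret (hT : IsMonotone (P.A + ofFun (linearization P.D (P.G P.z))))
    (hprox : ∀ ρ, 0 < ρ → ∃ x, P.IsProxPoint ρ x) (hδ : 0 < P.δ) (hθlo : 0 < P.θlo)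
    (hθ : P.θlo < P.θhi) {ρ₀ : ℝ} (hρ₀ : 0 < ρ₀) :
    ∃ ρ x y, P.Reaches (.init ρ₀) (.ret ρ x y) := by
  by_contra! hno
  have hnext : ∀ σ : {σ // P.Reaches (.init ρ₀) σ},
      ∃ σ' : {σ // P.Reaches (.init ρ₀) σ}, P.Step σ.1 σ'.1 := by
    rintro ⟨σ, hσ⟩
    have hv : P.IsValid σ := Reaches.isValid hT hδ hθlo hθ hσ hρ₀
    obtain ⟨σ', h⟩ := hv.exists_step hprox (by rintro ρ x y rfl; exact hno ρ x y hσ)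
    exact ⟨⟨σ', hσ.tail h⟩, h⟩
  choose f hf using hnext
  refine not_exists_infinite_execution hT hprox hδ hθlo hθ hρ₀
    ⟨fun k => (f^[k] ⟨_, Relation.ReflTransGen.refl⟩).1, rfl, fun k => ?_⟩
  dsimp only
  rw [Function.iterate_succ_apply']
  exact hf _

end BBData

theorem proposition5 {H : Type*} [NormedAddCommGroup H] [InnerProductSpace ℝ H] [CompleteSpace H]
    (P : BBData H)
    (hA : SetOp.IsMaximalMonotone P.A)
    (hBmono : SetOp.IsMonotone (SetOp.ofFun P.B)) (hBlip : LipschitzWith P.ℓ P.B)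
    (hβ : 0 < P.β) (hC : SetOp.IsCocoercive P.β P.C)
    (hDmono : SetOp.IsMonotone (SetOp.ofFun P.D)) (hDdiff : ContDiff ℝ 1 P.D)
    (hDlip : LipschitzWith P.m (fderiv ℝ P.D))
    (hδ : 0 < P.δ) (hθlo : 0 < P.θlo) (hθ : P.θlo < P.θhi)
    (hw : P.w ∉ (P.A + SetOp.ofFun P.B + SetOp.ofFun P.C + SetOp.ofFun P.D) (P.G P.z)) :
    ∀ ρ₀ : ℝ, 0 < ρ₀ →
      -- there is no infinite execution
      (¬ ∃ s : ℕ → BBState H, s 0 = .init ρ₀ ∧ ∀ k, P.Step (s k) (s (k + 1))) ∧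
      -- every execution can be continued until it returns `(ρ, x, y)`
      ∃ (ρ : ℝ) (x y : H),
        (∀ σ : BBState H, P.Reaches (.init ρ₀) σ → P.Reaches σ (.ret ρ x y)) ∧
        0 < ρ ∧
        SetOp.resolvent (ρ • (P.A + SetOp.ofFun (SetOp.linearization P.D (P.G P.z))))
          (P.G P.z + ρ • P.w - ρ • (P.B (P.G P.z) + P.C (P.G P.z))) = {x} ∧
        P.θlo ≤ 4 * (P.ℓ : ℝ) ^ 2 * ρ ^ 2 + ((P.β⁻¹).toReal + P.δ) * ρ
            + ((P.m : ℝ) * ρ * ‖x - P.G P.z‖) ^ 2 ∧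
        4 * (P.ℓ : ℝ) ^ 2 * ρ ^ 2 + ((P.β⁻¹).toReal + P.δ) * ρ
            + ((P.m : ℝ) * ρ * ‖x - P.G P.z‖) ^ 2 ≤ P.θhi ∧
        y = ρ⁻¹ • (P.G P.z - x) + P.w + (P.B x - P.B (P.G P.z))
            + (P.D x - SetOp.linearization P.D (P.G P.z) x) := by

  have hdiff : DifferentiableAt ℝ P.D (P.G P.z) := hDdiff.differentiable one_ne_zero _
  have hlin := SetOp.isMonotone_linearization hDmono hdiff
  have hT := hA.1.add_ofFun hlin
  have hprox : ∀ ρ, 0 < ρ → ∃ x, P.IsProxPoint ρ x := fun ρ hρ =>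
    hA.exists_resolvent_add_eq_singleton hlin
      (SetOp.lipschitzWith_linearization P.D (P.G P.z)) hρ _
  intro ρ₀ hρ₀
  refine ⟨BBData.not_exists_infinite_execution hT hprox hδ hθlo hθ hρ₀, ?_⟩
  obtain ⟨ρ, x, y, hret⟩ := BBData.exists_reaches_ret hT hprox hδ hθlo hθ hρ₀
  have hv : P.IsValid (.init ρ₀) := hρ₀
  obtain ⟨hρ, hx, h1, h2, hy⟩ := BBData.Reaches.isValid hT hδ hθlo hθ hret hv
  refine ⟨ρ, x, y, fun σ hσ => ?_, hρ, hx, h1, h2, hy⟩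
  -- Steps are deterministic, so `σ` and the returned state lie on one path, and nothing follows a
  -- returned state.
  rcases Relation.ReflTransGen.total_of_right_unique (BBData.Step.right_unique hθ) hσ hret with h | h
  · exact h
  · rcases h.cases_head with rfl | ⟨τ, hτ, -⟩
    · exact .refl
    · exact absurd hτ BBData.not_step_ret
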